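/- Let $\alpha>-1$ be real and let $m\ge 1$ be an integer. For $x,y>0$ put $W(x,y)=\dfrac{x^{\alpha}y^{\alpha+1}e^{-x-y}}{x+y}$, and for $k\ge 0$ let $$p_k(x)=\sqrt2\,(-1)^k\sum_{j=0}^k\frac{(-1)^j\,\Gamma(2\alpha+j+k+2)\,x^j}{j!\,\Gamma(\alpha+j+1)\,\Gamma(2\alpha+j+2)\,\Gamma(k-j+1)},$$ $$q_k(x)=\sqrt2\,(-1)^k(\alpha+k+1)\sum_{j=0}^k\frac{(-1)^j\,\Gamma(2\alpha+j+k+2)\,x^j}{j!\,\Gamma(\alpha+j+2)\,\Gamma(2\alpha+j+2)\,\Gamma(k-j+1)}$$ be the Cauchy-Laguerre biorthogonal polynomials. Let $S_k$ be the coefficient of $x^k$ in $p_k$ (equivalently, in $q_k$), let $h_k=\int_0^\infty\!\int_0^\infty p_k(x)q_k(y)W(x,y)\,dx\,dy$, and for $x,y<0$ let $$P_k(x)=\int_0^\infty\frac{v^{\alpha}e^{-v}}{x-v}\,p_k(v)\,dv,\qquad Q_k(y)=\int_0^\infty\frac{w^{\alpha+1}e^{-w}}{y-w}\,q_k(w)\,dw$$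 be the Cauchy transforms. For $x,y>0$ define the kernels $$K_{01}(x,y)=-x^{\alpha}e^{-x}\sum_{k=0}^{m-1}\frac1{h_k}\,p_k(y)\,Q_k(-x),\qquad K_{10}(x,y)=-y^{\alpha+1}e^{-y}\sum_{k=0}^{m-1}\frac1{h_k}\,P_k(-y)\,q_k(x).$$ Then, for all $k,l\ge0$, the function $p_k(x)q_l(y)W(x,y)$ is integrable on $(0,\infty)^2$ with integral $h_k\delta_{k,l}$, where $h_k\neq0$; and, for every $x>0$, the derivatives below exist and $$\frac{d}{dx}\bigl(xK_{01}(x,x)\bigr)=\frac{S_{m-1}}{S_m}\,x^{\alpha}e^{-x}\bigl(p_m(x)Q_{m-1}(-x)+p_{m-1}(x)Q_m(-x)\bigr),$$ $$\frac{d}{dx}\bigl(xK_{10}(x,x)\bigr)=\frac{S_{m-1}}{S_m}\,x^{\alpha+1}e^{-x}\bigl(P_m(-x)q_{m-1}(x)+P_{m-1}(-x)q_m(x)\bigr),$$ $$\begin{aligned}\frac{d}{dx}\Bigl(x\bigl(K_{01}(x,x)+K_{10}(x,x)\bigr)\Bigr)=-x^{\alpha}e^{-x}\Bigl(&a_1\bigl(q_{m-1}(x)Q_{m-2}(-x)-q_{m-2}(x)Q_{m-1}(-x)\bigr)\\&+a_2\bigl(q_{m-1}(x)Q_m(-x)-q_m(x)Q_{m-1}(-x)\bigr)\\&+a_3\bigl(q_{m+1}(x)Q_m(-x)-q_m(x)Q_{m+1}(-x)\bigr)\\&-x\bigl(a_4\,q_{m-1}(x)Q_{m-1}(-x)+a_5\,q_m(x)Q_m(-x)\bigr)\Bigr),\end{aligned}$$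 where $$a_1=\frac{(m-1)m(2\alpha+m)(2\alpha+m+1)}{4(\alpha+m)(2\alpha+2m-1)(2\alpha+2m+1)},\qquad a_2=\frac{m(2\alpha+m+1)(4\alpha^2+4\alpha+3m^2+6\alpha m+3m)}{4(\alpha+m)(\alpha+m+1)(2\alpha+2m+1)},$$ $$a_3=\frac{m(m+1)(2\alpha+m+1)(2\alpha+m+2)}{4(\alpha+m+1)(2\alpha+2m+1)(2\alpha+2m+3)},\qquad a_4=\frac{m(2\alpha+m+1)}{(\alpha+m)(2\alpha+2m+1)},\qquad a_5=\frac{m(2\alpha+m+1)}{(\alpha+m+1)(2\alpha+2m+1)},$$ and for $m=1$ one puts $a_1=0$, so that the terms with index $m-2$ are absent. -/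

import Mathlib

open MeasureTheory Set

namespace CauchyLaguerre

noncomputable section

/-- The Cauchy-Laguerre weight `W(x, y) = x ^ α * y ^ (α + 1) * e ^ (-x-y) / (x + y)`. -/
def W (α x y : ℝ) : ℝ :=
  x ^ α * y ^ (α + 1) * Real.exp (-x - y) / (x + y)

/-- The Cauchy-Laguerre biorthogonal polynomial `p_k`. -/
def p (α : ℝ) (k : ℕ) : Polynomial ℝ :=
  ∑ j ∈ Finset.range (k + 1), Polynomial.monomial j
    (√2 * (-1) ^ k * ((-1) ^ j * Real.Gamma (2 * α + j + k + 2) /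
      ((j.factorial : ℝ) * Real.Gamma (α + j + 1) * Real.Gamma (2 * α + j + 2) *
        Real.Gamma (-(j : ℝ) + k + 1))))

/-- The Cauchy-Laguerre biorthogonal polynomial `q_k`. -/
def q (α : ℝ) (k : ℕ) : Polynomial ℝ :=
  ∑ j ∈ Finset.range (k + 1), Polynomial.monomial j
    (√2 * (-1) ^ k * (α + k + 1) * ((-1) ^ j * Real.Gamma (2 * α + j + k + 2) /
      ((j.factorial : ℝ) * Real.Gamma (α + j + 2) * Real.Gamma (2 * α + j + 2) *
        Real.Gamma (-(j : ℝ) + k + 1))))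

/-- The highest-order coefficient `S_k` of `p_k` (it is also that of `q_k`, because
`Γ(α + k + 2) = (α + k + 1) Γ(α + k + 1)`). -/
def S (α : ℝ) (k : ℕ) : ℝ := (p α k).leadingCoeff

/-- The pairing `∫∫ p_k(x) q_l(y) W(x, y) dx dy` over the open quadrant `x, y > 0`. -/
def pairing (α : ℝ) (k l : ℕ) : ℝ :=
  ∫ z in Ioi (0 : ℝ) ×ˢ Ioi (0 : ℝ), (p α k).eval z.1 * (q α l).eval z.2 * W α z.1 z.2

/-- The normalizing constant `h_k` of the biorthogonality relation. -/
def h (α : ℝ) (k : ℕ) : ℝ := pairing α k k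

/-- The Cauchy transform `P_k` of `p_k` (used for negative arguments only). -/
def P (α : ℝ) (k : ℕ) (x : ℝ) : ℝ :=
  ∫ v in Ioi (0 : ℝ), v ^ α * Real.exp (-v) / (x - v) * (p α k).eval v

/-- The Cauchy transform `Q_k` of `q_k` (used for negative arguments only). -/
def Q (α : ℝ) (k : ℕ) (y : ℝ) : ℝ :=
  ∫ w in Ioi (0 : ℝ), w ^ (α + 1) * Real.exp (-w) / (y - w) * (q α k).eval w

/-- The correlation kernel `K_01(x, y)`. -/
def K01 (α : ℝ) (m : ℕ) (x y : ℝ) : ℝ :=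
  -x ^ α * Real.exp (-x) *
    ∑ k ∈ Finset.range m, 1 / h α k * ((p α k).eval y * Q α k (-x))

/-- The correlation kernel `K_10(x, y)`. -/
def K10 (α : ℝ) (m : ℕ) (x y : ℝ) : ℝ :=
  -y ^ (α + 1) * Real.exp (-y) *
    ∑ k ∈ Finset.range m, 1 / h α k * (P α k (-y) * (q α k).eval x)

/-- The coefficient `a_1`. It vanishes for `m = 1`. -/
def a1 (α : ℝ) (m : ℕ) : ℝ :=
  ((m - 1 : ℝ) * m * (2 * α + m) * (2 * α + m + 1)) /
    (4 * (α + m) * (2 * α + 2 * m - 1) * (2 * α + 2 * m + 1))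

/-- The coefficient `a_2`. -/
def a2 (α : ℝ) (m : ℕ) : ℝ :=
  (m * (2 * α + m + 1) *
      (4 * α ^ 2 + 4 * α + 3 * (m : ℝ) ^ 2 + 6 * α * m + 3 * m)) /
    (4 * (α + m) * (α + m + 1) * (2 * α + 2 * m + 1))

/-- The coefficient `a_3`. -/
def a3 (α : ℝ) (m : ℕ) : ℝ :=
  (m * (m + 1) * (2 * α + m + 1) * (2 * α + m + 2)) /
    (4 * (α + m + 1) * (2 * α + 2 * m + 1) * (2 * α + 2 * m + 3))

/-- The coefficient `a_4`. -/
def a4 (α : ℝ) (m : ℕ) : ℝ :=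
  (m * (2 * α + m + 1)) / ((α + m) * (2 * α + 2 * m + 1))

/-- The coefficient `a_5`. -/
def a5 (α : ℝ) (m : ℕ) : ℝ :=
  (m * (2 * α + m + 1)) / ((α + m + 1) * (2 * α + 2 * m + 1))

end

end CauchyLaguerre

namespace CauchyLaguerre

open Polynomial

/-! Everything rests on the operator `eulerOp (α + 1)`, that is `f ↦ X f' + (α + 1) f - X f`. It is
skew-adjoint for the Cauchy-Laguerre pairing (`bilin_eulerOp`), and it acts on both families as a
three-term operator with the same constants `ratio α k` (`eulerOp_p`, `eulerOp_q`). Skewness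
propagates biorthogonality from `p α 0` to all `k`, so every `h α k` equals `1` (`bilin_p_q`);
comparing top coefficients identifies `S α k / S α (k + 1)` with `ratio α (k + 1)`.

The same operator governs the kernels. Both `x d/dx` of a weighted polynomial and `x d/dx` of a
Stieltjes transform (`hasDerivAt_stieltjes`) become Euler operators on polynomials. The derivative
of `x K(x, x)` is then a sum over `k` that the structure relations make telescope
(`sum_structure_relation`), leaving only the terms at `m` and `m - 1`.

For the third formula, `p` is eliminated in favour of `q` by two relations: `eulerOp_add_X_mul_q`,
which expresses `(α + k + 1) p_k` through `q_{k-1}, q_k, q_{k+1}`, and `p_succ_sub_p`, which turns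
the mixed products of indices `m`, `m - 1` into diagonal ones. Both pass to the transforms, the
moments cancelling. -/

/-- The coefficients of the Jacobi polynomials on `[0, 1]` for the weight `s ^ (2 * α + 1)`,
normalized to have the value `1` at `s = 1`. -/
noncomputable def jacobiCoeff (α : ℝ) (k j : ℕ) : ℝ :=
  (-1) ^ k * ((-1) ^ j * Real.Gamma (2 * α + j + k + 2) /
    ((j.factorial : ℝ) * Real.Gamma (2 * α + j + 2) * Real.Gamma (-(j : ℝ) + k + 1)))

/-- The off-diagonal coefficient of the structure relations of `p` and `q`. -/
noncomputable def ratio (α : ℝ) (k : ℕ) : ℝ := k * (2 * α + k + 1) / (2 * (2 * α + 2 * k + 1))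

/-- The operator `f ↦ X f' + a f - X f`, the conjugate of the Euler operator by
`x ^ a * exp (-x)`. -/
noncomputable def eulerOp (a : ℝ) (f : ℝ[X]) : ℝ[X] := X * derivative f + C a * f - X * f

/-! ### Recurrences for the Jacobi coefficients. -/

theorem gamma_eq_zero_of_lt {k j : ℕ} (hkj : k < j) : Real.Gamma (-(j : ℝ) + k + 1) = 0 := by
  obtain ⟨i, rfl⟩ := Nat.exists_eq_add_of_lt hkj
  rw [← Real.Gamma_neg_nat_eq_zero i]
  congr 1
  push_cast
  ring

theorem jacobiCoeff_eq_zero_of_lt (α : ℝ) {k j : ℕ} (hkj : k < j) : jacobiCoeff α k j = 0 := by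
  simp [jacobiCoeff, gamma_eq_zero_of_lt hkj]

/-- No bound on `j` is needed: beyond the degree, the convention that `Γ` is `0` at its poles makes
`jacobiCoeff` vanish. Coefficient comparisons can thus ignore the summation range. -/
theorem coeff_p (α : ℝ) (k j : ℕ) :
    (p α k).coeff j = √2 * jacobiCoeff α k j / Real.Gamma (α + j + 1) := by
  simp only [p, finsetSum_coeff, coeff_monomial, Finset.sum_ite_eq', Finset.mem_range]
  split_ifs with hj
  · rw [jacobiCoeff]
    ring
  · rw [jacobiCoeff_eq_zero_of_lt α (by omega)]
    simp

theorem coeff_q (α : ℝ) (k j : ℕ) :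
    (q α k).coeff j = √2 * (α + k + 1) * jacobiCoeff α k j / Real.Gamma (α + j + 2) := by
  simp only [q, finsetSum_coeff, coeff_monomial, Finset.sum_ite_eq', Finset.mem_range]
  split_ifs with hj
  · rw [jacobiCoeff]
    ring
  · rw [jacobiCoeff_eq_zero_of_lt α (by omega)]
    simp

/-- Since `1 / Γ` is entire, its functional equation has no exceptional points; the junk value `Γ 0
= 0` agrees with this at `s = 0`. -/
theorem inv_gamma_eq (s : ℝ) : (Real.Gamma s)⁻¹ = s * (Real.Gamma (s + 1))⁻¹ := by
  rcases eq_or_ne s 0 with rfl | hs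
  · simp
  · rw [Real.Gamma_add_one hs, mul_inv, mul_inv_cancel_left₀ hs]

theorem jacobiCoeff_succ_left {α : ℝ} (hα : -1 < α) (k j : ℕ) :
    ((k : ℝ) + 1 - j) * jacobiCoeff α (k + 1) j = -(2 * α + j + k + 2) * jacobiCoeff α k j := by
  have h1 : Real.Gamma (2 * α + j + (k + 1 : ℕ) + 2)
      = (2 * α + j + k + 2) * Real.Gamma (2 * α + j + k + 2) := by
    rw [← Real.Gamma_add_one (by have := k.cast_nonneg (α := ℝ); have := j.cast_nonneg (α := ℝ); linarith)]
    congr 1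
    push_cast
    ring
  have h2 := inv_gamma_eq (-(j : ℝ) + k + 1)
  have h3 : -(j : ℝ) + (k + 1 : ℕ) + 1 = -(j : ℝ) + k + 1 + 1 := by push_cast; ring
  simp only [jacobiCoeff, div_eq_mul_inv, mul_inv, h1, h3, h2, pow_succ]
  ring

theorem jacobiCoeff_succ_succ {α : ℝ} (hα : -1 < α) (k j : ℕ) :
    ((j : ℝ) + 1) * (2 * α + j + 2) * jacobiCoeff α (k + 1) (j + 1)
      = (2 * α + j + k + 3) * (2 * α + j + k + 2) * jacobiCoeff α k j := by
  have hk : (0 : ℝ) ≤ k := k.cast_nonneg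
  have hj : (0 : ℝ) ≤ j := j.cast_nonneg
  have h1 : Real.Gamma (2 * α + (j + 1 : ℕ) + (k + 1 : ℕ) + 2)
      = (2 * α + j + k + 3) * ((2 * α + j + k + 2) * Real.Gamma (2 * α + j + k + 2)) := by
    rw [← Real.Gamma_add_one (by linarith), show 2 * α + (j + 1 : ℕ) + (k + 1 : ℕ) + 2
      = (2 * α + j + k + 3) + 1 by push_cast; ring, Real.Gamma_add_one (by linarith)]
    congr 2
    ring
  have h2 : Real.Gamma (2 * α + (j + 1 : ℕ) + 2)
      = (2 * α + j + 2) * Real.Gamma (2 * α + j + 2) := by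
    rw [← Real.Gamma_add_one (by linarith)]
    congr 1
    push_cast
    ring
  have h3 : -((j + 1 : ℕ) : ℝ) + (k + 1 : ℕ) + 1 = -(j : ℝ) + k + 1 := by push_cast; ring
  have h4 : (2 * α + j + 2) ≠ 0 := by linarith
  have h5 : ((j : ℝ) + 1) ≠ 0 := by positivity
  simp only [jacobiCoeff, h1, h3, h2, pow_succ, Nat.factorial_succ, Nat.cast_mul]
  push_cast
  field_simp

/-- Follows by eliminating `jacobiCoeff α (k + 1) (j + 1)` between the two preceding recurrences. -/
theorem jacobiCoeff_succ_right {α : ℝ} (hα : -1 < α) (k j : ℕ) :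
    ((j : ℝ) + 1) * (2 * α + j + 2) * jacobiCoeff α k (j + 1)
      = -(2 * α + j + k + 2) * (k - j) * jacobiCoeff α k j := by
  have hk : (0 : ℝ) ≤ k := k.cast_nonneg
  have hj : (0 : ℝ) ≤ j := j.cast_nonneg
  have h1 := jacobiCoeff_succ_succ hα k j
  have h2 := jacobiCoeff_succ_left hα k (j + 1)
  push_cast at h2
  have h3 : 2 * α + j + k + 3 ≠ 0 := by linarith
  apply mul_left_cancel₀ h3
  linear_combination (-(k : ℝ) + j) * h1 + (j + 1) * (2 * α + j + 2) * h2

theorem jacobiCoeff_zero_zero {α : ℝ} (hα : -1 < α) : jacobiCoeff α 0 0 = 1 := by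
  have : Real.Gamma (2 * α + 2) ≠ 0 := (Real.Gamma_pos_of_pos (by linarith)).ne'
  simp [jacobiCoeff, this]

theorem ratio_zero (α : ℝ) : ratio α 0 = 0 := by simp [ratio]

/-- The coefficients of the backward shift of the Jacobi polynomial. -/
noncomputable def jacobiShift (α : ℝ) (k : ℕ) : ℕ → ℝ
  | 0 => 0
  | j + 1 => jacobiCoeff α k j

/-- The denominator of `ratio` can vanish only at `k = 0`, `α = -1/2`, where both sides are `0`. -/
theorem ratio_mul {α : ℝ} (hα : -1 < α) (k : ℕ) :
    2 * (2 * α + 2 * k + 1) * ratio α k = k * (2 * α + k + 1) := by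
  rcases k with _ | k
  · simp [ratio_zero]
  · have hk : (0 : ℝ) ≤ k := k.cast_nonneg
    rw [ratio]
    push_cast
    exact mul_div_cancel₀ _ (by linarith)

/-- All neighbouring coefficients are polynomial multiples of one number `u`, so three-term
identities reduce to polynomial ones. The assumption on `j + k` keeps `2 * α + j + k + 1` nonzero.
The factor `ratio α k` in the last equation absorbs the truncated index `k - 1` at `k = 0`. -/
theorem exists_jacobiCoeff_eq {α : ℝ} (hα : -1 < α) {k j : ℕ} (hkj : 1 ≤ j + k) :
    ∃ u, jacobiCoeff α (k + 1) j = (2 * α + j + k + 2) * (2 * α + j + k + 1) * u ∧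
      jacobiCoeff α k j = -((k : ℝ) + 1 - j) * (2 * α + j + k + 1) * u ∧
      jacobiShift α k j = j * (2 * α + j + 1) * u ∧
      ratio α k * jacobiCoeff α (k - 1) j = ratio α k * ((k - j) * (k + 1 - j) * u) := by
  have hkj' : (1 : ℝ) ≤ j + k := by exact_mod_cast hkj
  have h1 : 2 * α + j + k + 2 ≠ 0 := by linarith
  have h2 : 2 * α + j + k + 1 ≠ 0 := by linarith
  obtain ⟨u, e1⟩ : ∃ u, jacobiCoeff α (k + 1) j
      = (2 * α + j + k + 2) * (2 * α + j + k + 1) * u :=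
    ⟨_, (mul_div_cancel₀ _ (mul_ne_zero h1 h2)).symm⟩
  have e2 : jacobiCoeff α k j = -((k : ℝ) + 1 - j) * (2 * α + j + k + 1) * u := by
    apply mul_left_cancel₀ h1
    linear_combination jacobiCoeff_succ_left hα k j - ((k : ℝ) + 1 - j) * e1
  refine ⟨u, e1, e2, ?_, ?_⟩
  · rcases j with _ | j
    · simp [jacobiShift]
    · apply mul_left_cancel₀ h1
      apply mul_left_cancel₀ h2
      have := jacobiCoeff_succ_succ hα k j
      simp only [jacobiShift]
      push_cast at e1 this ⊢
      linear_combination -this + (j + 1) * (2 * α + j + 2) * e1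
  · rcases k with _ | k
    · simp [ratio_zero]
    · congr 1
      apply mul_left_cancel₀ h2
      have := jacobiCoeff_succ_left hα k j
      rw [Nat.add_sub_cancel]
      push_cast at this e2 ⊢
      linear_combination this - ((k : ℝ) + 1 - j) * e2

theorem jacobiCoeff_one_zero {α : ℝ} (hα : -1 < α) : jacobiCoeff α 1 0 = -(2 * α + 2) := by
  have := jacobiCoeff_succ_left hα 0 0
  rw [jacobiCoeff_zero_zero hα] at this
  norm_num at this ⊢
  linarith

theorem jacobiCoeff_eulerOp {α : ℝ} (hα : -1 < α) (k j : ℕ) :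
    (j + (α + 1)) * jacobiCoeff α k j - (α + j) * jacobiShift α k j
      = -ratio α (k + 1) * jacobiCoeff α (k + 1) j
        + (ratio α (k + 1) - ratio α k) * jacobiCoeff α k j
        + ratio α k * jacobiCoeff α (k - 1) j := by
  have hr := ratio_mul hα k
  have hr' := ratio_mul hα (k + 1)
  by_cases hkj : 1 ≤ j + k
  · obtain ⟨u, e1, e2, e3, e4⟩ := exists_jacobiCoeff_eq hα hkj
    rw [e1, e2, e3, e4]
    push_cast at hr hr'
    linear_combination u / 2 * (2 * α + j + k + 1) * hr' - u / 2 * (k + 1 - j) * hr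
  · obtain ⟨rfl, rfl⟩ : j = 0 ∧ k = 0 := by omega
    rw [jacobiCoeff_one_zero hα, jacobiCoeff_zero_zero hα, ratio_zero]
    simp only [jacobiShift]
    push_cast at hr' ⊢
    linear_combination -hr' / 2

theorem jacobiCoeff_eulerOp_dual {α : ℝ} (hα : -1 < α) (k j : ℕ) :
    (α + k + 1) * ((j + (α + 1)) * jacobiCoeff α k j - (α + j + 1) * jacobiShift α k j)
      = ratio α k * (α + k) * jacobiCoeff α (k - 1) j
        - (ratio α (k + 1) - ratio α k) * (α + k + 1) * jacobiCoeff α k j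
        - ratio α (k + 1) * (α + k + 2) * jacobiCoeff α (k + 1) j := by
  have hr := ratio_mul hα k
  have hr' := ratio_mul hα (k + 1)
  by_cases hkj : 1 ≤ j + k
  · obtain ⟨u, e1, e2, e3, e4⟩ := exists_jacobiCoeff_eq hα hkj
    rw [mul_right_comm, e4, e1, e2, e3]
    push_cast at hr hr'
    linear_combination u / 2 * (α + j + 1) * ((2 * α + j + k + 1) * hr' + (k + 1 - j) * hr)
  · obtain ⟨rfl, rfl⟩ : j = 0 ∧ k = 0 := by omega
    rw [jacobiCoeff_one_zero hα, jacobiCoeff_zero_zero hα, ratio_zero]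
    simp only [jacobiShift]
    push_cast at hr' ⊢
    linear_combination -(α + 1) / 2 * hr'

/-! ### Structure relations of the polynomials. -/

theorem coeff_eulerOp_zero (a : ℝ) (f : ℝ[X]) : (eulerOp a f).coeff 0 = a * f.coeff 0 := by
  simp [eulerOp]

theorem coeff_eulerOp_succ (a : ℝ) (f : ℝ[X]) (j : ℕ) :
    (eulerOp a f).coeff (j + 1) = ((j + 1 : ℕ) + a) * f.coeff (j + 1) - f.coeff j := by
  simp [eulerOp, coeff_X_mul, coeff_derivative]
  ring

theorem inv_gamma_pred {α : ℝ} (j : ℕ) :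
    (Real.Gamma (α + j + 1))⁻¹ = (α + j + 1) * (Real.Gamma (α + j + 2))⁻¹ := by
  rw [inv_gamma_eq, show α + j + 1 + 1 = α + j + 2 by ring]

theorem eulerOp_p {α : ℝ} (hα : -1 < α) (k : ℕ) :
    eulerOp (α + 1) (p α k) = -C (ratio α (k + 1)) * p α (k + 1)
      + C (ratio α (k + 1) - ratio α k) * p α k + C (ratio α k) * p α (k - 1) := by
  ext j
  rw [← C_neg]
  simp only [coeff_add, coeff_C_mul]
  have h := jacobiCoeff_eulerOp hα k j
  rcases j with _ | j
  · rw [coeff_eulerOp_zero]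
    simp only [coeff_p, jacobiShift, div_eq_mul_inv] at h ⊢
    push_cast at h ⊢
    linear_combination √2 * (Real.Gamma (α + 0 + 1))⁻¹ * h
  · rw [coeff_eulerOp_succ]
    simp only [coeff_p, jacobiShift, div_eq_mul_inv, inv_gamma_pred j] at h ⊢
    push_cast at h ⊢
    rw [show α + (j + 1 : ℝ) + 1 = α + j + 2 by ring]
    linear_combination √2 * (Real.Gamma (α + j + 2))⁻¹ * h

theorem eulerOp_q {α : ℝ} (hα : -1 < α) (k : ℕ) :
    eulerOp (α + 1) (q α k) = C (ratio α k) * q α (k - 1)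
      - C (ratio α (k + 1) - ratio α k) * q α k - C (ratio α (k + 1)) * q α (k + 1) := by
  have hr : ∀ j, ratio α k * (α + (k - 1 : ℕ) + 1) * jacobiCoeff α (k - 1) j
      = ratio α k * (α + k) * jacobiCoeff α (k - 1) j := by
    intro j
    rcases k with _ | k
    · simp [ratio_zero]
    · simp [add_assoc]
  ext j
  simp only [coeff_sub, coeff_C_mul]
  have h := jacobiCoeff_eulerOp_dual hα k j
  have hr := hr j
  rcases j with _ | j
  · rw [coeff_eulerOp_zero]
    simp only [coeff_q, jacobiShift, div_eq_mul_inv] at h ⊢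
    push_cast at h ⊢
    linear_combination √2 * (Real.Gamma (α + 0 + 2))⁻¹ * (h - hr)
  · rw [coeff_eulerOp_succ]
    have h2 := inv_gamma_eq (α + j + 2)
    simp only [coeff_q, jacobiShift, div_eq_mul_inv, h2] at h ⊢
    push_cast at h ⊢
    rw [show α + (j + 1 : ℝ) + 2 = α + j + 2 + 1 by ring]
    linear_combination √2 * (Real.Gamma (α + j + 2 + 1))⁻¹ * (h - hr)

/-- The left side multiplies the `j`-th coefficient by `α + j + 1`, which turns `1 / Γ(α + j + 2)`
into `1 / Γ(α + j + 1)`. -/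
theorem eulerOp_add_X_mul_q {α : ℝ} (k : ℕ) :
    eulerOp (α + 1) (q α k) + X * q α k = C (α + k + 1) * p α k := by
  ext j
  simp only [coeff_add, coeff_C_mul]
  rcases j with _ | j
  · rw [coeff_eulerOp_zero]
    simp only [coeff_q, coeff_p, div_eq_mul_inv, inv_gamma_pred, coeff_X_mul_zero]
    push_cast
    ring
  · rw [coeff_eulerOp_succ]
    simp only [coeff_q, coeff_p, div_eq_mul_inv, inv_gamma_pred, coeff_X_mul]
    push_cast
    ring

theorem p_succ_sub_p {α : ℝ} (hα : -1 < α) (k : ℕ) :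
    p α (k + 1) - p α k = q α (k + 1) + q α k := by
  ext j
  simp only [coeff_add, coeff_sub, coeff_q, coeff_p, div_eq_mul_inv, inv_gamma_pred]
  push_cast
  linear_combination √2 * (Real.Gamma (α + j + 2))⁻¹ * (-jacobiCoeff_succ_left hα k j)

/-! ### Moments and Stieltjes transforms. -/

/-- The moment functional of the Laguerre weight `w ^ a * exp (-w)`. -/
noncomputable def moment (a : ℝ) (f : ℝ[X]) : ℝ :=
  ∫ w in Ioi (0 : ℝ), w ^ a * Real.exp (-w) * f.eval w

/-- The Stieltjes transform of `f` times the Laguerre weight `w ^ a * exp (-w)`. -/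
noncomputable def stieltjes (a : ℝ) (f : ℝ[X]) (x : ℝ) : ℝ :=
  ∫ w in Ioi (0 : ℝ), w ^ a * Real.exp (-w) * (x + w)⁻¹ * f.eval w

theorem rpow_exp_mul_monomial {a w : ℝ} (hw : 0 < w) (n : ℕ) (c : ℝ) :
    w ^ a * Real.exp (-w) * (monomial n c).eval w
      = c * (Real.exp (-w) * w ^ (a + n + 1 - 1)) := by
  rw [eval_monomial, add_sub_cancel_right, Real.rpow_add_natCast hw.ne']
  ring

theorem integrableOn_weight_mul_eval {a : ℝ} (ha : -1 < a) (f : ℝ[X]) :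
    IntegrableOn (fun w : ℝ => w ^ a * Real.exp (-w) * f.eval w) (Ioi 0) := by
  induction f using Polynomial.induction_on' with
  | add f g hf hg =>
    simp only [eval_add, mul_add]
    exact hf.add hg
  | monomial n c =>
    have hn : 0 < a + n + 1 := by linarith [n.cast_nonneg (α := ℝ)]
    refine IntegrableOn.congr_fun ((Real.GammaIntegral_convergent hn).const_mul c)
      (fun w hw => (rpow_exp_mul_monomial hw n c).symm) measurableSet_Ioi

theorem integrableOn_weight_mul_bdd_mul_eval {a : ℝ} (ha : -1 < a) (f : ℝ[X]) {φ : ℝ → ℝ}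
    (hφ : Measurable φ) {B : ℝ} (hB : ∀ w, 0 < w → |φ w| ≤ B) :
    IntegrableOn (fun w : ℝ => w ^ a * Real.exp (-w) * φ w * f.eval w) (Ioi 0) := by
  have h := integrableOn_weight_mul_eval ha f
  refine (h.norm.const_mul B).mono' ?_ ?_
  · exact Measurable.aestronglyMeasurable (by fun_prop)
  · refine (ae_restrict_mem measurableSet_Ioi).mono fun w hw => ?_
    rw [mul_right_comm, norm_mul, mul_comm]
    exact mul_le_mul_of_nonneg_right (hB w hw) (norm_nonneg _)

theorem abs_inv_add_le {x w : ℝ} (hx : 0 < x) (hw : 0 < w) : |(x + w)⁻¹| ≤ x⁻¹ := by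
  rw [abs_of_pos (by positivity)]
  exact inv_anti₀ hx (by linarith)

theorem abs_inv_add_sq_le {x w : ℝ} (hx : 0 < x) (hw : 0 < w) :
    |((x + w) ^ 2)⁻¹| ≤ (x ^ 2)⁻¹ := by
  rw [abs_of_pos (by positivity)]
  exact inv_anti₀ (by positivity) (by gcongr; linarith)

theorem integrableOn_stieltjes {a x : ℝ} (ha : -1 < a) (hx : 0 < x) (f : ℝ[X]) :
    IntegrableOn (fun w : ℝ => w ^ a * Real.exp (-w) * (x + w)⁻¹ * f.eval w) (Ioi 0) :=
  integrableOn_weight_mul_bdd_mul_eval ha f (by fun_prop) fun _ hw => abs_inv_add_le hx hw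

theorem integrableOn_stieltjes_sq {a x : ℝ} (ha : -1 < a) (hx : 0 < x) (f : ℝ[X]) :
    IntegrableOn (fun w : ℝ => w ^ a * Real.exp (-w) * ((x + w) ^ 2)⁻¹ * f.eval w) (Ioi 0) :=
  integrableOn_weight_mul_bdd_mul_eval ha f (by fun_prop) fun _ hw => abs_inv_add_sq_le hx hw

theorem moment_add {a : ℝ} (ha : -1 < a) (f g : ℝ[X]) :
    moment a (f + g) = moment a f + moment a g := by
  simp only [moment, eval_add, mul_add]
  exact integral_add (integrableOn_weight_mul_eval ha f) (integrableOn_weight_mul_eval ha g)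

theorem moment_C_mul (a c : ℝ) (f : ℝ[X]) : moment a (C c * f) = c * moment a f := by
  simp only [moment, eval_mul, eval_C, ← integral_const_mul]
  congr 1 with w
  ring

theorem moment_neg (a : ℝ) (f : ℝ[X]) : moment a (-f) = -moment a f := by
  simp only [moment, eval_neg, mul_neg, integral_neg]

theorem moment_monomial {a : ℝ} (ha : -1 < a) (n : ℕ) (c : ℝ) :
    moment a (monomial n c) = c * Real.Gamma (a + n + 1) := by
  have hn : 0 < a + n + 1 := by linarith [n.cast_nonneg (α := ℝ)]
  rw [moment, Real.Gamma_eq_integral hn, ← integral_const_mul]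
  exact setIntegral_congr_fun measurableSet_Ioi fun w hw => rpow_exp_mul_monomial hw n c

theorem moment_X_mul (a : ℝ) (f : ℝ[X]) : moment a (X * f) = moment (a + 1) f := by
  refine setIntegral_congr_fun measurableSet_Ioi fun w hw => ?_
  replace hw : 0 < w := hw
  simp only [eval_mul, eval_X, Real.rpow_add_one hw.ne']
  ring

theorem eulerOp_add (a : ℝ) (f g : ℝ[X]) : eulerOp a (f + g) = eulerOp a f + eulerOp a g := by
  simp only [eulerOp, derivative_add]
  ring

theorem eulerOp_monomial (a : ℝ) (n : ℕ) (c : ℝ) :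
    eulerOp a (monomial n c) = monomial n (c * (n + a)) + monomial (n + 1) (-c) := by
  ext j
  rcases j with _ | j
  · rw [coeff_eulerOp_zero]
    simp only [coeff_add, coeff_monomial]
    rcases n with _ | n
    · simp
      ring
    · simp
  · rw [coeff_eulerOp_succ]
    simp only [coeff_add, coeff_monomial, add_left_inj]
    split_ifs with h1 h2 h3
    · omega
    · subst h1
      push_cast
      ring
    · ring
    · ring

theorem eulerOp_add_one (a : ℝ) (f : ℝ[X]) : eulerOp (a + 1) f = eulerOp a f + f := by
  simp only [eulerOp, C_add, C_1]
  ring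

theorem moment_eulerOp {a : ℝ} (ha : -1 < a) (f : ℝ[X]) : moment a (eulerOp (a + 1) f) = 0 := by
  induction f using Polynomial.induction_on' with
  | add f g hf hg => rw [eulerOp_add, moment_add ha, hf, hg, add_zero]
  | monomial n c =>
    have hn : a + n + 1 ≠ 0 := by linarith [n.cast_nonneg (α := ℝ)]
    rw [eulerOp_monomial, moment_add ha, moment_monomial ha, moment_monomial ha,
      show a + (n + 1 : ℕ) + 1 = a + n + 1 + 1 by push_cast; ring, Real.Gamma_add_one hn]
    ring

theorem p_zero (α : ℝ) (hα : -1 < α) : p α 0 = monomial 0 (√2 / Real.Gamma (α + 1)) := by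
  ext j
  rw [coeff_p, coeff_monomial]
  rcases j with _ | j
  · simp [jacobiCoeff_zero_zero hα]
  · simp [jacobiCoeff_eq_zero_of_lt α (Nat.succ_pos j)]

theorem ratio_succ_pos {α : ℝ} (hα : -1 < α) (k : ℕ) : 0 < ratio α (k + 1) := by
  have hk : (0 : ℝ) ≤ k := k.cast_nonneg
  have h1 : 0 < 2 * α + (k + 1) + 1 := by linarith
  have h2 : 0 < 2 * α + 2 * (k + 1) + 1 := by linarith
  rw [ratio]
  push_cast
  positivity

/-- The moment functional kills the image of `eulerOp (α + 1)`, and the coefficients in `eulerOp_p`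
sum to zero; hence the moments form a constant sequence. -/
theorem moment_p {α : ℝ} (hα : -1 < α) (k : ℕ) : moment α (p α k) = √2 := by
  induction k using Nat.strong_induction_on with
  | _ k ih =>
  rcases k with _ | k
  · have : Real.Gamma (α + 1) ≠ 0 := (Real.Gamma_pos_of_pos (by linarith)).ne'
    rw [p_zero α hα, moment_monomial hα]
    simp [this]
  · have h := moment_eulerOp hα (p α k)
    rw [eulerOp_p hα, neg_mul, moment_add hα, moment_add hα, moment_neg, moment_C_mul,
      moment_C_mul, moment_C_mul, ih k (Nat.lt_succ_self k), ih (k - 1) (by omega)] at h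
    apply mul_left_cancel₀ (ratio_succ_pos hα k).ne'
    linear_combination -h

theorem moment_q {α : ℝ} (hα : -1 < α) (k : ℕ) :
    moment (α + 1) (q α k) = √2 * (α + k + 1) := by
  have h := congrArg (moment α) (eulerOp_add_X_mul_q (α := α) k)
  rw [moment_add hα, moment_eulerOp hα, moment_X_mul, moment_C_mul, moment_p hα] at h
  linarith

theorem stieltjes_add {a x : ℝ} (ha : -1 < a) (hx : 0 < x) (f g : ℝ[X]) :
    stieltjes a (f + g) x = stieltjes a f x + stieltjes a g x := by
  simp only [stieltjes, eval_add, mul_add]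
  exact integral_add (integrableOn_stieltjes ha hx f) (integrableOn_stieltjes ha hx g)

theorem stieltjes_C_mul (a c : ℝ) (f : ℝ[X]) (x : ℝ) :
    stieltjes a (C c * f) x = c * stieltjes a f x := by
  simp only [stieltjes, eval_mul, eval_C, ← integral_const_mul]
  congr 1 with w
  ring

theorem stieltjes_neg (a : ℝ) (f : ℝ[X]) (x : ℝ) : stieltjes a (-f) x = -stieltjes a f x := by
  simp only [stieltjes, eval_neg, mul_neg, integral_neg]

theorem stieltjes_sub {a x : ℝ} (ha : -1 < a) (hx : 0 < x) (f g : ℝ[X]) :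
    stieltjes a (f - g) x = stieltjes a f x - stieltjes a g x := by
  rw [sub_eq_add_neg, stieltjes_add ha hx, stieltjes_neg, sub_eq_add_neg]

theorem stieltjes_X_mul {a x : ℝ} (ha : -1 < a) (hx : 0 < x) (f : ℝ[X]) :
    stieltjes a (X * f) x = moment a f - x * stieltjes a f x := by
  rw [moment, stieltjes, stieltjes, ← integral_const_mul, ← integral_sub
    (integrableOn_weight_mul_eval ha f) ((integrableOn_stieltjes ha hx f).const_mul x)]
  refine setIntegral_congr_fun measurableSet_Ioi fun w hw => ?_
  replace hw : 0 < w := hw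
  have : x + w ≠ 0 := by positivity
  simp only [eval_mul, eval_X]
  field_simp
  ring

theorem stieltjes_add_one {a x : ℝ} (f : ℝ[X]) :
    stieltjes (a + 1) f x = stieltjes a (X * f) x := by
  refine setIntegral_congr_fun measurableSet_Ioi fun w hw => ?_
  replace hw : 0 < w := hw
  simp only [eval_mul, eval_X, Real.rpow_add_one hw.ne']
  ring

/-- Integration by parts against the Cauchy kernel. -/
theorem stieltjes_eulerOp_add_one {a x : ℝ} (ha : -1 < a) (hx : 0 < x) (f : ℝ[X]) :
    stieltjes a (eulerOp (a + 1) f) x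
      = ∫ w in Ioi (0 : ℝ), w ^ (a + 1) * Real.exp (-w) * ((x + w) ^ 2)⁻¹ * f.eval w := by
  have ha' : -1 < a + 1 := by linarith
  have hd : ∀ w ∈ Ioi (0 : ℝ), HasDerivAt
      (fun w : ℝ => w ^ (a + 1) * Real.exp (-w) * (x + w)⁻¹ * f.eval w)
      (w ^ a * Real.exp (-w) * (x + w)⁻¹ * (eulerOp (a + 1) f).eval w
        - w ^ (a + 1) * Real.exp (-w) * ((x + w) ^ 2)⁻¹ * f.eval w) w := by
    intro w (hw : 0 < w)
    have hxw : x + w ≠ 0 := by positivity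
    have h1 := Real.hasDerivAt_rpow_const (x := w) (p := a + 1) (Or.inl hw.ne')
    have h2 := (hasDerivAt_neg w).exp
    have h3 := ((hasDerivAt_id w).const_add x).inv hxw
    refine (((h1.mul h2).mul h3).mul (f.hasDerivAt w)).congr_deriv ?_
    simp only [eulerOp, eval_sub, eval_add, eval_mul, eval_X, eval_C, add_sub_cancel_right,
      Real.rpow_add_one hw.ne', id, Pi.mul_apply, Pi.inv_apply]
    field_simp
    ring
  have hi1 := integrableOn_stieltjes ha hx (eulerOp (a + 1) f)
  have hi2 := integrableOn_stieltjes_sq ha' hx f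
  have hc : ContinuousWithinAt
      (fun w : ℝ => w ^ (a + 1) * Real.exp (-w) * (x + w)⁻¹ * f.eval w) (Ici 0) 0 := by
    have h1 : ContinuousAt (fun w : ℝ => w ^ (a + 1)) 0 :=
      Real.continuousAt_rpow_const _ _ (Or.inr (by linarith))
    have h3 : ContinuousAt (fun w : ℝ => (x + w)⁻¹) 0 :=
      ContinuousAt.inv₀ (by fun_prop) (by simpa using hx.ne')
    exact (((h1.mul (by fun_prop)).mul h3).mul f.continuous.continuousAt).continuousWithinAt
  -- The boundary term at infinity vanishes because the function and its derivative are both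
  -- integrable; the one at `0` vanishes because `a + 1 > 0`.
  have ht := tendsto_zero_of_hasDerivAt_of_integrableOn_Ioi hd (hi1.sub hi2)
    (integrableOn_stieltjes ha' hx f)
  have h := integral_Ioi_of_hasDerivAt_of_tendsto hc hd (hi1.sub hi2) ht
  rw [integral_sub hi1 hi2] at h
  rw [stieltjes, ← sub_eq_zero, h, Real.zero_rpow (by linarith)]
  simp

theorem hasDerivAt_stieltjes {a x : ℝ} (ha : -1 < a) (hx : 0 < x) (f : ℝ[X]) :
    HasDerivAt (stieltjes a f) (stieltjes a (eulerOp a f) x / x) x := by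
  have ha' : -1 < a + 1 := by linarith
  have key := hasDerivAt_integral_of_dominated_loc_of_deriv_le
    (μ := volume.restrict (Ioi (0 : ℝ))) (x₀ := x) (s := Ioi (x / 2))
    (F := fun x w => w ^ a * Real.exp (-w) * (x + w)⁻¹ * f.eval w)
    (F' := fun x w => -(w ^ a * Real.exp (-w) * ((x + w) ^ 2)⁻¹ * f.eval w))
    (bound := fun w => ((x / 2) ^ 2)⁻¹ * ‖w ^ a * Real.exp (-w) * f.eval w‖)
    (Ioi_mem_nhds (by linarith))
    (Filter.Eventually.of_forall fun y => Measurable.aestronglyMeasurable (by fun_prop))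
    (integrableOn_stieltjes ha hx f)
    (Measurable.aestronglyMeasurable (by fun_prop))
    ?_ ((integrableOn_weight_mul_eval ha f).norm.const_mul _) ?_
  · have h := key.2
    have e : ∫ w in Ioi (0 : ℝ), -(w ^ a * Real.exp (-w) * ((x + w) ^ 2)⁻¹ * f.eval w)
        = stieltjes a (eulerOp a f) x / x := by
      -- Integration by parts combines with `x / (x + w) ^ 2 + w / (x + w) ^ 2 = 1 / (x + w)`.
      have h1 := stieltjes_eulerOp_add_one ha hx f
      rw [eulerOp_add_one, stieltjes_add ha hx] at h1
      rw [eq_div_iff hx.ne', eq_sub_of_add_eq h1, integral_neg, neg_mul, neg_eq_iff_eq_neg,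
        neg_sub, eq_sub_iff_add_eq, mul_comm, ← integral_const_mul,
        ← integral_add ((integrableOn_stieltjes_sq ha hx f).const_mul x)
        (integrableOn_stieltjes_sq ha' hx f)]
      refine setIntegral_congr_fun measurableSet_Ioi fun w hw => ?_
      replace hw : 0 < w := hw
      have : x + w ≠ 0 := by positivity
      simp only [Real.rpow_add_one hw.ne']
      field_simp
    rw [← e]
    exact h
  · refine (ae_restrict_mem measurableSet_Ioi).mono fun w (hw : 0 < w) y (hy : x / 2 < y) => ?_
    rw [mul_right_comm, norm_neg, norm_mul, mul_comm]
    refine mul_le_mul_of_nonneg_right ?_ (norm_nonneg _)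
    refine (abs_inv_add_sq_le ((half_pos hx).trans hy) hw).trans ?_
    exact inv_anti₀ (by positivity) (by gcongr)
  · refine (ae_restrict_mem measurableSet_Ioi).mono fun w (hw : 0 < w) y (hy : x / 2 < y) => ?_
    have hyw : y + w ≠ 0 := by linarith [half_pos hx]
    have h := ((((hasDerivAt_id y).add_const w).inv hyw).const_mul
      (w ^ a * Real.exp (-w))).mul_const (f.eval w)
    refine h.congr_deriv ?_
    simp only [id]
    field_simp

theorem P_neg (α : ℝ) (k : ℕ) (x : ℝ) : P α k (-x) = -stieltjes α (p α k) x := by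
  rw [P, stieltjes, ← integral_neg]
  congr 1 with w
  rw [show -x - w = -(x + w) by ring, div_neg, div_eq_mul_inv]
  ring

theorem Q_neg (α : ℝ) (k : ℕ) (x : ℝ) : Q α k (-x) = -stieltjes (α + 1) (q α k) x := by
  rw [Q, stieltjes, ← integral_neg]
  congr 1 with w
  rw [show -x - w = -(x + w) by ring, div_neg, div_eq_mul_inv]
  ring

/-! ### Integrals against the Cauchy weight. -/

theorem integral_weight_exp {a t : ℝ} (ha : -1 < a) (ht : 0 < t) :
    ∫ x in Ioi (0 : ℝ), x ^ a * Real.exp (-(t * x)) = t ^ (-(a + 1)) * Real.Gamma (a + 1) := by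
  have h := Real.integral_rpow_mul_exp_neg_mul_Ioi (a := a + 1) (by linarith) ht
  rwa [add_sub_cancel_right, one_div, Real.inv_rpow ht.le, ← Real.rpow_neg ht.le] at h

theorem integrableOn_weight_exp {a t : ℝ} (ha : -1 < a) (ht : 0 < t) :
    IntegrableOn (fun x : ℝ => x ^ a * Real.exp (-(t * x))) (Ioi 0) := by
  refine Integrable.of_integral_ne_zero ?_
  rw [integral_weight_exp ha ht]
  have := Real.Gamma_pos_of_pos (show 0 < a + 1 by linarith)
  positivity

theorem integral_exp_Ioi_one {s : ℝ} (hs : 0 < s) :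
    ∫ t in Ioi (1 : ℝ), Real.exp (-(t * s)) = Real.exp (-s) / s := by
  have h := integral_exp_mul_Ioi (a := -s) (by linarith) 1
  rw [mul_one, neg_div_neg_eq] at h
  rw [← h]
  congr 1 with t
  ring_nf

/-- The integrand of the representation of the Cauchy weight as a superposition of products. -/
noncomputable def cauchyKernel (a b t : ℝ) (z : ℝ × ℝ) : ℝ :=
  z.1 ^ a * Real.exp (-(t * z.1)) * (z.2 ^ b * Real.exp (-(t * z.2)))

theorem integral_cauchyKernel {a b t : ℝ} (ha : -1 < a) (hb : -1 < b) (ht : 0 < t) :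
    ∫ z, cauchyKernel a b t z ∂((volume.restrict (Ioi (0 : ℝ))).prod (volume.restrict (Ioi 0)))
      = Real.Gamma (a + 1) * Real.Gamma (b + 1) * t ^ (-(a + b + 2)) := by
  have h := integral_prod_mul (μ := volume.restrict (Ioi (0 : ℝ)))
    (ν := volume.restrict (Ioi (0 : ℝ))) (fun x : ℝ => x ^ a * Real.exp (-(t * x)))
    (fun y : ℝ => y ^ b * Real.exp (-(t * y)))
  rw [integral_weight_exp ha ht, integral_weight_exp hb ht] at h
  simp only [cauchyKernel, h]
  rw [show -(a + b + 2) = -(a + 1) + -(b + 1) by ring, Real.rpow_add ht]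
  ring

theorem cauchyKernel_nonneg_ae (a b t : ℝ) :
    ∀ᵐ z ∂((volume.restrict (Ioi (0 : ℝ))).prod (volume.restrict (Ioi 0))),
      0 ≤ cauchyKernel a b t z := by
  rw [Measure.prod_restrict]
  refine (ae_restrict_mem (measurableSet_Ioi.prod measurableSet_Ioi)).mono fun z hz => ?_
  have h1 : 0 < z.1 := hz.1
  have h2 : 0 < z.2 := hz.2
  rw [cauchyKernel]
  positivity

/-- Justifies Fubini for `exp (-s) / s = ∫ exp (-t s) dt` over `t > 1` with `s = x + y`. By
positivity the inner norm integral is a multiple of `t ^ (-(a + b + 2))`, integrable at infinity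
since `a + b + 1 > 0`. -/
theorem integrable_cauchyKernel {a b : ℝ} (ha : -1 < a) (hb : -1 < b) (hab : 0 < a + b + 1) :
    Integrable (Function.uncurry (cauchyKernel a b)) ((volume.restrict (Ioi (1 : ℝ))).prod
      ((volume.restrict (Ioi (0 : ℝ))).prod (volume.restrict (Ioi 0)))) := by
  rw [integrable_prod_iff]
  · constructor
    · refine (ae_restrict_mem measurableSet_Ioi).mono fun t (ht : 1 < t) => ?_
      have ht : 0 < t := by linarith
      exact (integrableOn_weight_exp ha ht).mul_prod (integrableOn_weight_exp hb ht)
    · have h : IntegrableOn (fun t : ℝ =>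
          Real.Gamma (a + 1) * Real.Gamma (b + 1) * t ^ (-(a + b + 2))) (Ioi 1) :=
        (integrableOn_Ioi_rpow_of_lt (by linarith) one_pos).const_mul _
      refine h.congr_fun (fun t ht => ?_) measurableSet_Ioi
      refine (integral_cauchyKernel ha hb (one_pos.trans ht)).symm.trans ?_
      refine integral_congr_ae ((cauchyKernel_nonneg_ae a b t).mono fun z hz => ?_)
      exact (Real.norm_of_nonneg hz).symm
  · refine Measurable.aestronglyMeasurable ?_
    unfold Function.uncurry cauchyKernel
    fun_prop

theorem integral_cauchyKernel_left {a b : ℝ} {z : ℝ × ℝ} (hz : z ∈ Ioi (0 : ℝ) ×ˢ Ioi (0 : ℝ)) :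
    ∫ t in Ioi (1 : ℝ), cauchyKernel a b t z
      = z.1 ^ a * z.2 ^ b * Real.exp (-z.1 - z.2) / (z.1 + z.2) := by
  have h1 : 0 < z.1 := hz.1
  have h2 : 0 < z.2 := hz.2
  rw [mul_div_assoc, show -z.1 - z.2 = -(z.1 + z.2) by ring,
    ← integral_exp_Ioi_one (add_pos h1 h2), ← integral_const_mul]
  congr 1 with t
  rw [cauchyKernel, mul_add, neg_add, Real.exp_add]
  ring

theorem integrableOn_cauchy {a b : ℝ} (ha : -1 < a) (hb : -1 < b) (hab : 0 < a + b + 1) :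
    IntegrableOn (fun z : ℝ × ℝ => z.1 ^ a * z.2 ^ b * Real.exp (-z.1 - z.2) / (z.1 + z.2))
      (Ioi (0 : ℝ) ×ˢ Ioi (0 : ℝ)) := by
  have h := (integrable_cauchyKernel ha hb hab).integral_prod_right
  rw [Measure.prod_restrict] at h
  exact IntegrableOn.congr_fun h (fun z hz => integral_cauchyKernel_left hz)
    (measurableSet_Ioi.prod measurableSet_Ioi)

theorem integral_cauchy {a b : ℝ} (ha : -1 < a) (hb : -1 < b) (hab : 0 < a + b + 1) :
    ∫ z in Ioi (0 : ℝ) ×ˢ Ioi (0 : ℝ),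
      z.1 ^ a * z.2 ^ b * Real.exp (-z.1 - z.2) / (z.1 + z.2)
      = Real.Gamma (a + 1) * Real.Gamma (b + 1) / (a + b + 1) := by
  have h := integral_integral_swap (integrable_cauchyKernel ha hb hab)
  rw [setIntegral_congr_fun measurableSet_Ioi
    fun t ht => integral_cauchyKernel ha hb (one_pos.trans ht), integral_const_mul,
    integral_Ioi_rpow_of_lt (by linarith) one_pos, Real.one_rpow, Measure.prod_restrict] at h
  rw [setIntegral_congr_fun (measurableSet_Ioi.prod measurableSet_Ioi)
    (fun z hz => (integral_cauchyKernel_left (a := a) (b := b) hz).symm)]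
  refine h.symm.trans ?_
  rw [show -(a + b + 2) + 1 = -(a + b + 1) by ring, neg_div_neg_eq]
  ring

/-! ### Skew-adjointness, biorthogonality and leading coefficients. -/

/-- The bilinear pairing of two polynomials against the Cauchy-Laguerre weight. -/
noncomputable def bilin (α : ℝ) (f g : ℝ[X]) : ℝ :=
  ∫ z in Ioi (0 : ℝ) ×ˢ Ioi (0 : ℝ), f.eval z.1 * g.eval z.2 * W α z.1 z.2

theorem monomial_mul_W {α : ℝ} (i j : ℕ) (c d : ℝ) {z : ℝ × ℝ}
    (hz : z ∈ Ioi (0 : ℝ) ×ˢ Ioi (0 : ℝ)) :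
    (monomial i c).eval z.1 * (monomial j d).eval z.2 * W α z.1 z.2
      = c * d * (z.1 ^ (α + i) * z.2 ^ (α + 1 + j) * Real.exp (-z.1 - z.2) / (z.1 + z.2)) := by
  have h1 : 0 < z.1 := hz.1
  have h2 : 0 < z.2 := hz.2
  rw [eval_monomial, eval_monomial, W, Real.rpow_add_natCast h1.ne',
    Real.rpow_add_natCast h2.ne']
  ring

theorem integrableOn_bilin {α : ℝ} (hα : -1 < α) (f g : ℝ[X]) :
    IntegrableOn (fun z : ℝ × ℝ => f.eval z.1 * g.eval z.2 * W α z.1 z.2)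
      (Ioi (0 : ℝ) ×ˢ Ioi (0 : ℝ)) := by
  induction f using Polynomial.induction_on' with
  | add f f' hf hf' =>
    simp only [eval_add, add_mul]
    exact hf.add hf'
  | monomial i c =>
    induction g using Polynomial.induction_on' with
    | add g g' hg hg' =>
      simp only [eval_add, mul_add, add_mul]
      exact hg.add hg'
    | monomial j d =>
      have hi : (0 : ℝ) ≤ i := i.cast_nonneg
      have hj : (0 : ℝ) ≤ j := j.cast_nonneg
      exact IntegrableOn.congr_fun
        ((integrableOn_cauchy (a := α + i) (b := α + 1 + j) (by linarith) (by linarith)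
          (by linarith)).const_mul (c * d)) (fun z hz => (monomial_mul_W i j c d hz).symm)
        (measurableSet_Ioi.prod measurableSet_Ioi)

theorem bilin_monomial {α : ℝ} (hα : -1 < α) (i j : ℕ) (c d : ℝ) :
    bilin α (monomial i c) (monomial j d)
      = c * d * (Real.Gamma (α + i + 1) * Real.Gamma (α + j + 2) / (2 * α + i + j + 2)) := by
  have hi : (0 : ℝ) ≤ i := i.cast_nonneg
  have hj : (0 : ℝ) ≤ j := j.cast_nonneg
  have h := integral_cauchy (a := α + i) (b := α + 1 + j) (by linarith) (by linarith)
    (by linarith)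
  rw [bilin, setIntegral_congr_fun (measurableSet_Ioi.prod measurableSet_Ioi)
    (fun z hz => monomial_mul_W i j c d hz), integral_const_mul, h]
  congr 2
  · ring_nf
  · ring

theorem bilin_add_left {α : ℝ} (hα : -1 < α) (f f' g : ℝ[X]) :
    bilin α (f + f') g = bilin α f g + bilin α f' g := by
  simp only [bilin, eval_add, add_mul]
  exact integral_add (integrableOn_bilin hα f g) (integrableOn_bilin hα f' g)

theorem bilin_add_right {α : ℝ} (hα : -1 < α) (f g g' : ℝ[X]) :
    bilin α f (g + g') = bilin α f g + bilin α f g' := by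
  simp only [bilin, eval_add, mul_add, add_mul]
  exact integral_add (integrableOn_bilin hα f g) (integrableOn_bilin hα f g')

theorem bilin_C_mul_left (α c : ℝ) (f g : ℝ[X]) :
    bilin α (C c * f) g = c * bilin α f g := by
  simp only [bilin, eval_mul, eval_C, ← integral_const_mul]
  congr 1 with z
  ring

theorem bilin_C_mul_right (α c : ℝ) (f g : ℝ[X]) :
    bilin α f (C c * g) = c * bilin α f g := by
  simp only [bilin, eval_mul, eval_C, ← integral_const_mul]
  congr 1 with z
  ring

theorem bilin_neg_left (α : ℝ) (f g : ℝ[X]) : bilin α (-f) g = -bilin α f g := by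
  simp only [bilin, eval_neg, neg_mul, integral_neg]

theorem bilin_sub_right {α : ℝ} (hα : -1 < α) (f g g' : ℝ[X]) :
    bilin α f (g - g') = bilin α f g - bilin α f g' := by
  rw [eq_sub_iff_add_eq, ← bilin_add_right hα, sub_add_cancel]

/-- The operator `eulerOp (α + 1)` is skew-adjoint for the pairing. -/
theorem bilin_eulerOp {α : ℝ} (hα : -1 < α) (f g : ℝ[X]) :
    bilin α (eulerOp (α + 1) f) g + bilin α f (eulerOp (α + 1) g) = 0 := by
  induction f using Polynomial.induction_on' with
  | add f f' hf hf' =>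
    rw [eulerOp_add, bilin_add_left hα, bilin_add_left hα]
    linear_combination hf + hf'
  | monomial i c =>
    induction g using Polynomial.induction_on' with
    | add g g' hg hg' =>
      rw [eulerOp_add, bilin_add_right hα, bilin_add_right hα]
      linear_combination hg + hg'
    | monomial j d =>
      have hi : (0 : ℝ) ≤ i := i.cast_nonneg
      have hj : (0 : ℝ) ≤ j := j.cast_nonneg
      simp only [eulerOp_monomial, bilin_add_left hα, bilin_add_right hα, bilin_monomial hα]
      rw [show α + (i + 1 : ℕ) + 1 = α + i + 1 + 1 by push_cast; ring,
        show α + (j + 1 : ℕ) + 2 = α + j + 2 + 1 by push_cast; ring,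
        Real.Gamma_add_one (s := α + i + 1) (by linarith),
        Real.Gamma_add_one (s := α + j + 2) (by linarith)]
      -- The undifferentiated terms have total weight `D / D` and the shifted ones `(D + 1) / (D +
      -- 1)`, so they cancel.
      obtain ⟨D, hD⟩ : ∃ D : ℝ, D = 2 * α + i + j + 2 := ⟨_, rfl⟩
      have h1 : D ≠ 0 := by linarith
      have h2 : D + 1 ≠ 0 := by linarith
      rw [show 2 * α + (i + 1 : ℕ) + j + 2 = D + 1 by push_cast; linarith,
        show 2 * α + i + (j + 1 : ℕ) + 2 = D + 1 by push_cast; linarith, ← hD]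
      have hi' : (i : ℝ) = D - 2 * α - j - 2 := by linarith
      generalize Real.Gamma (α + i + 1) = A
      generalize Real.Gamma (α + j + 2) = B
      rw [hi']
      field_simp
      ring

/-- The partial sums telescope by `jacobiCoeff_succ_right`. At `n = l + 1` the right side is `0`:
the Jacobi polynomial of degree `l ≥ 1` is orthogonal to constants. -/
theorem sum_jacobiCoeff_div {α : ℝ} (hα : -1 < α) (l n : ℕ) :
    l * (2 * α + l + 2) * ∑ j ∈ Finset.range n, jacobiCoeff α l j / (2 * α + j + 2)
      = -(n * jacobiCoeff α l n) := by
  induction n with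
  | zero => simp
  | succ n ih =>
    have hn : (0 : ℝ) ≤ n := n.cast_nonneg
    have h0 : 2 * α + n + 2 ≠ 0 := by linarith
    have h := jacobiCoeff_succ_right hα l n
    rw [Finset.sum_range_succ, mul_add, ih]
    apply mul_left_cancel₀ h0
    have e : (2 * α + n + 2) * (l * (2 * α + l + 2) * (jacobiCoeff α l n / (2 * α + n + 2)))
        = l * (2 * α + l + 2) * jacobiCoeff α l n := by
      field_simp
    push_cast
    linear_combination e + h

theorem bilin_p_zero_q {α : ℝ} (hα : -1 < α) (l : ℕ) :
    bilin α (p α 0) (q α l) = if 0 = l then 1 else 0 := by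
  have hG : Real.Gamma (α + 1) ≠ 0 := (Real.Gamma_pos_of_pos (by linarith)).ne'
  have hsum : bilin α (p α 0) (q α l)
      = 2 * (α + l + 1) * ∑ j ∈ Finset.range (l + 1), jacobiCoeff α l j / (2 * α + j + 2) := by
    have h := map_sum (AddMonoidHom.mk' (bilin α (p α 0)) (bilin_add_right hα (p α 0)))
      (fun j => monomial j ((q α l).coeff j)) (Finset.range (l + 1))
    simp only [AddMonoidHom.mk'_apply] at h
    have hq : q α l = ∑ j ∈ Finset.range (l + 1), monomial j ((q α l).coeff j) := by
      refine as_sum_range' _ _ (Nat.lt_succ_of_le (natDegree_le_iff_coeff_eq_zero.2 ?_))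
      intro j hj
      simp [coeff_q, jacobiCoeff_eq_zero_of_lt α hj]
    rw [← hq] at h
    rw [h, Finset.mul_sum]
    refine Finset.sum_congr rfl fun j _ => ?_
    have hj : (0 : ℝ) ≤ j := j.cast_nonneg
    have hG' : Real.Gamma (α + j + 2) ≠ 0 := (Real.Gamma_pos_of_pos (by linarith)).ne'
    rw [p_zero α hα, bilin_monomial hα, coeff_q]
    have h2 : √2 * √2 = 2 := Real.mul_self_sqrt (by norm_num)
    have h3 : 2 * α + (0 : ℕ) + j + 2 = 2 * α + j + 2 := by push_cast; ring
    have h4 : α + (0 : ℕ) + 1 = α + 1 := by push_cast; ring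
    have h5 : 2 * α + j + 2 ≠ 0 := by linarith
    rw [h3, h4]
    generalize 2 * α + (j : ℝ) + 2 = D at h5 ⊢
    field_simp
    linear_combination (α + l + 1) * jacobiCoeff α l j * h2
  rw [hsum]
  rcases l with _ | l
  · have : α + 1 ≠ 0 := by linarith
    simp only [zero_add, Finset.range_one, Finset.sum_singleton, jacobiCoeff_zero_zero hα,
      if_true]
    push_cast
    rw [show 2 * α + 0 + 2 = 2 * (α + 1) by ring, add_zero]
    field_simp
  · have hl : (0 : ℝ) ≤ l := l.cast_nonneg
    have h := sum_jacobiCoeff_div hα (l + 1) (l + 1 + 1)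
    rw [jacobiCoeff_eq_zero_of_lt α (Nat.lt_succ_self (l + 1)), mul_zero, neg_zero] at h
    have h1 : ((l + 1 : ℕ) : ℝ) * (2 * α + (l + 1 : ℕ) + 2) ≠ 0 := by
      push_cast
      exact mul_ne_zero (by positivity) (by linarith)
    rw [(mul_eq_zero.1 h).resolve_left h1]
    simp

/-- Skew-adjointness determines row `k + 1` of the pairing matrix from rows `k` and `k - 1`; the
identity matrix obeys the same recurrence (`e1`, `e2`, `e3`). -/
theorem bilin_p_q {α : ℝ} (hα : -1 < α) (k l : ℕ) :
    bilin α (p α k) (q α l) = if k = l then 1 else 0 := by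
  induction k using Nat.strong_induction_on generalizing l with
  | _ k ih =>
  rcases k with _ | k
  · exact bilin_p_zero_q hα l
  · have h := bilin_eulerOp hα (p α k) (q α l)
    rw [eulerOp_p hα, eulerOp_q hα, neg_mul] at h
    simp only [bilin_add_left hα, bilin_sub_right hα, bilin_neg_left,
      bilin_C_mul_left, bilin_C_mul_right, ih k (Nat.lt_succ_self k),
      ih (k - 1) (Nat.lt_succ_of_le (Nat.sub_le _ _))] at h
    apply mul_left_cancel₀ (ratio_succ_pos hα k).ne'
    have e1 : ratio α k * (if k - 1 = l then 1 else 0) - ratio α (l + 1) *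
        (if k = l + 1 then 1 else 0) = 0 := by
      rcases k with _ | k
      · simp [ratio_zero]
      · by_cases hkl : k = l
        · simp [hkl]
        · simp [hkl]
    have e2 : ratio α l * (if k = l - 1 then 1 else 0)
        = ratio α (k + 1) * (if k + 1 = l then 1 else 0) := by
      rcases l with _ | l
      · simp [ratio_zero]
      · by_cases hkl : k = l
        · simp [hkl]
        · simp [hkl]
    have e3 : (ratio α (k + 1) - ratio α k) * (if k = l then 1 else 0)
        = (ratio α (l + 1) - ratio α l) * (if k = l then 1 else 0) := by
      by_cases hkl : k = l
      · simp [hkl]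
      · simp [hkl]
    linear_combination -h + e1 + e2 + e3

theorem h_eq_one {α : ℝ} (hα : -1 < α) (k : ℕ) : h α k = 1 :=
  (bilin_p_q hα k k).trans (if_pos rfl)

/-- Compares coefficients of degree `k + 1` in `eulerOp_p`. -/
theorem coeff_p_self {α : ℝ} (hα : -1 < α) (k : ℕ) :
    (p α k).coeff k = ratio α (k + 1) * (p α (k + 1)).coeff (k + 1) := by
  have h1 : ∀ l, l < k + 1 → (p α l).coeff (k + 1) = 0 := fun l hl => by
    simp [coeff_p, jacobiCoeff_eq_zero_of_lt α hl]
  have h := congrArg (fun f => coeff f (k + 1)) (eulerOp_p hα k)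
  simp only [coeff_eulerOp_succ, neg_mul, coeff_add, coeff_neg, coeff_C_mul, h1 k k.lt_succ_self,
    h1 (k - 1) (Nat.lt_succ_of_le (Nat.sub_le _ _))] at h
  linear_combination -h

theorem coeff_p_self_ne_zero {α : ℝ} (hα : -1 < α) (k : ℕ) : (p α k).coeff k ≠ 0 := by
  induction k with
  | zero =>
    have := Real.Gamma_pos_of_pos (show 0 < α + 1 by linarith)
    rw [p_zero α hα, coeff_monomial, if_pos rfl]
    positivity
  | succ k ih =>
    rw [coeff_p_self hα] at ih
    exact right_ne_zero_of_mul ih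

theorem S_eq_coeff {α : ℝ} (hα : -1 < α) (k : ℕ) : S α k = (p α k).coeff k := by
  have h : (p α k).natDegree = k := by
    refine le_antisymm (natDegree_le_iff_coeff_eq_zero.2 fun j hj => ?_)
      (le_natDegree_of_ne_zero (coeff_p_self_ne_zero hα k))
    simp [coeff_p, jacobiCoeff_eq_zero_of_lt α hj]
  rw [S, leadingCoeff, h]

theorem S_div_S {α : ℝ} (hα : -1 < α) (k : ℕ) : S α k / S α (k + 1) = ratio α (k + 1) := by
  rw [S_eq_coeff hα, S_eq_coeff hα, coeff_p_self hα,
    mul_div_cancel_right₀ _ (coeff_p_self_ne_zero hα (k + 1))]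

/-! ### Derivatives of the diagonal kernels. -/

theorem hasDerivAt_mul_weight_mul {a x u' : ℝ} (hx : 0 < x) (f : ℝ[X]) {u : ℝ → ℝ}
    (hu : HasDerivAt u (u' / x) x) :
    HasDerivAt (fun t : ℝ => t * (t ^ a * Real.exp (-t) * (f.eval t * u t)))
      (x ^ a * Real.exp (-x) * ((eulerOp (a + 1) f).eval x * u x + f.eval x * u')) x := by
  have h1 := Real.hasDerivAt_rpow_const (x := x) (p := a) (Or.inl hx.ne')
  have h2 := (hasDerivAt_neg x).exp
  refine ((hasDerivAt_id x).mul ((h1.mul h2).mul ((f.hasDerivAt x).mul hu))).congr_deriv ?_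
  simp only [eulerOp, eval_sub, eval_add, eval_mul, eval_X, eval_C, id, Pi.mul_apply,
    Real.rpow_sub_one hx.ne']
  field_simp
  ring

theorem eval_eulerOp_p {α : ℝ} (hα : -1 < α) (k : ℕ) (x : ℝ) :
    (eulerOp (α + 1) (p α k)).eval x = -ratio α (k + 1) * (p α (k + 1)).eval x
      + (ratio α (k + 1) - ratio α k) * (p α k).eval x + ratio α k * (p α (k - 1)).eval x := by
  rw [eulerOp_p hα]
  simp only [eval_add, eval_mul, eval_neg, eval_C]

theorem eval_eulerOp_q {α : ℝ} (hα : -1 < α) (k : ℕ) (x : ℝ) :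
    (eulerOp (α + 1) (q α k)).eval x = ratio α k * (q α (k - 1)).eval x
      - (ratio α (k + 1) - ratio α k) * (q α k).eval x
      - ratio α (k + 1) * (q α (k + 1)).eval x := by
  rw [eulerOp_q hα]
  simp only [eval_sub, eval_mul, eval_C]

theorem stieltjes_eulerOp_p {α a x : ℝ} (hα : -1 < α) (ha : -1 < a) (hx : 0 < x) (k : ℕ) :
    stieltjes a (eulerOp (α + 1) (p α k)) x = -ratio α (k + 1) * stieltjes a (p α (k + 1)) x
      + (ratio α (k + 1) - ratio α k) * stieltjes a (p α k) x
      + ratio α k * stieltjes a (p α (k - 1)) x := by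
  rw [eulerOp_p hα, ← C_neg, stieltjes_add ha hx, stieltjes_add ha hx]
  simp only [stieltjes_C_mul]

theorem stieltjes_eulerOp_q {α a x : ℝ} (hα : -1 < α) (ha : -1 < a) (hx : 0 < x) (k : ℕ) :
    stieltjes a (eulerOp (α + 1) (q α k)) x = ratio α k * stieltjes a (q α (k - 1)) x
      - (ratio α (k + 1) - ratio α k) * stieltjes a (q α k) x
      - ratio α (k + 1) * stieltjes a (q α (k + 1)) x := by
  rw [eulerOp_q hα, stieltjes_sub ha hx, stieltjes_sub ha hx]
  simp only [stieltjes_C_mul]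

/-- The diagonal products cancel and the rest telescopes; `ratio α 0 = 0` removes the lower boundary
term. -/
theorem sum_structure_relation (α : ℝ) (A B : ℕ → ℝ) (m : ℕ) :
    ∑ k ∈ Finset.range m, ((-ratio α (k + 1) * A (k + 1) + (ratio α (k + 1) - ratio α k) * A k
        + ratio α k * A (k - 1)) * B k
      + A k * (ratio α k * B (k - 1) - (ratio α (k + 1) - ratio α k) * B k
        - ratio α (k + 1) * B (k + 1)))
      = -ratio α m * (A m * B (m - 1) + A (m - 1) * B m) := by
  induction m with
  | zero => simp [ratio_zero]
  | succ m ih =>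
    rw [Finset.sum_range_succ, ih, Nat.add_sub_cancel]
    ring

theorem hasDerivAt_mul_K01 {α x : ℝ} (hα : -1 < α) (m : ℕ) (hx : 0 < x) :
    HasDerivAt (fun t : ℝ => t * K01 α m t t)
      (x ^ α * Real.exp (-x) * (-ratio α m *
        ((p α m).eval x * stieltjes (α + 1) (q α (m - 1)) x
          + (p α (m - 1)).eval x * stieltjes (α + 1) (q α m) x))) x := by
  have hα' : -1 < α + 1 := by linarith
  have hK : (fun t : ℝ => t * K01 α m t t) = fun t => ∑ k ∈ Finset.range m,
      t * (t ^ α * Real.exp (-t) * ((p α k).eval t * stieltjes (α + 1) (q α k) t)) := by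
    ext t
    simp only [K01, h_eq_one hα, Q_neg, Finset.mul_sum]
    refine Finset.sum_congr rfl fun k _ => ?_
    ring
  rw [hK, ← sum_structure_relation α (fun k => (p α k).eval x)
    (fun k => stieltjes (α + 1) (q α k) x), Finset.mul_sum]
  refine HasDerivAt.fun_sum fun k _ => ?_
  refine (hasDerivAt_mul_weight_mul hx (p α k)
    (hasDerivAt_stieltjes hα' hx (q α k))).congr_deriv ?_
  rw [eval_eulerOp_p hα, stieltjes_eulerOp_q hα hα' hx]

theorem hasDerivAt_mul_K10 {α x : ℝ} (hα : -1 < α) (m : ℕ) (hx : 0 < x) :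
    HasDerivAt (fun t : ℝ => t * K10 α m t t)
      (x ^ (α + 1) * Real.exp (-x) * (-ratio α m *
        (stieltjes α (p α m) x * (q α (m - 1)).eval x
          + stieltjes α (p α (m - 1)) x * (q α m).eval x))) x := by
  have hK : (fun t : ℝ => t * K10 α m t t) = fun t => ∑ k ∈ Finset.range m,
      t * (t ^ (α + 1) * Real.exp (-t) * ((q α k).eval t * stieltjes α (p α k) t)) := by
    ext t
    simp only [K10, h_eq_one hα, P_neg, Finset.mul_sum]
    refine Finset.sum_congr rfl fun k _ => ?_
    ring
  rw [hK, ← sum_structure_relation α (fun k => stieltjes α (p α k) x) (fun k => (q α k).eval x),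
    Finset.mul_sum]
  refine HasDerivAt.fun_sum fun k _ => ?_
  refine (hasDerivAt_mul_weight_mul hx (q α k)
    (hasDerivAt_stieltjes hα hx (p α k))).congr_deriv ?_
  -- The natural parameters here are `α + 2` for `q` and `α` for `p`; relative to `α + 1` they
  -- contribute opposite copies of one product, which cancel.
  have h1 := stieltjes_eulerOp_p hα hα hx k
  rw [eulerOp_add_one α (p α k), stieltjes_add hα hx] at h1
  rw [eulerOp_add_one, eval_add, eval_eulerOp_q hα]
  linear_combination x ^ (α + 1) * Real.exp (-x) * (q α k).eval x * h1

/-! ### Elimination of `p` and the coefficients of the third formula. -/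

theorem mul_eval_p {α : ℝ} (hα : -1 < α) (k : ℕ) (x : ℝ) :
    (α + k + 1) * (p α k).eval x = x * (q α k).eval x + ratio α k * (q α (k - 1)).eval x
      - (ratio α (k + 1) - ratio α k) * (q α k).eval x
      - ratio α (k + 1) * (q α (k + 1)).eval x := by
  have h := congrArg (eval x) (eulerOp_add_X_mul_q (α := α) k)
  rw [eval_add, eval_eulerOp_q hα, eval_mul, eval_mul, eval_X, eval_C] at h
  linear_combination -h

theorem mul_stieltjes_p {α x : ℝ} (hα : -1 < α) (hx : 0 < x) (k : ℕ) :
    x * stieltjes α (p α k) x = √2 - stieltjes (α + 1) (p α k) x := by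
  rw [stieltjes_add_one, stieltjes_X_mul hα hx, moment_p hα]
  ring

/-- Transform of `eulerOp_add_X_mul_q`: the inhomogeneous term `√2 * (α + k + 1)` cancels against
`moment_q`. Apart from the term with factor `x`, the signs are opposite to those in `mul_eval_p`. -/
theorem mul_mul_stieltjes_p {α x : ℝ} (hα : -1 < α) (hx : 0 < x) (k : ℕ) :
    (α + k + 1) * (x * stieltjes α (p α k) x) = x * stieltjes (α + 1) (q α k) x
      - ratio α k * stieltjes (α + 1) (q α (k - 1)) x
      + (ratio α (k + 1) - ratio α k) * stieltjes (α + 1) (q α k) x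
      + ratio α (k + 1) * stieltjes (α + 1) (q α (k + 1)) x := by
  have hα' : -1 < α + 1 := by linarith
  have h := congrArg (fun f => stieltjes (α + 1) f x) (eulerOp_add_X_mul_q (α := α) k)
  simp only [stieltjes_add hα' hx, stieltjes_eulerOp_q hα hα' hx, stieltjes_X_mul hα' hx,
    stieltjes_C_mul, moment_q hα] at h
  rw [mul_stieltjes_p hα hx]
  linear_combination h

theorem mul_stieltjes_p_succ_sub {α x : ℝ} (hα : -1 < α) (hx : 0 < x) (k : ℕ) :
    x * stieltjes α (p α (k + 1)) x - x * stieltjes α (p α k) x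
      = -(stieltjes (α + 1) (q α (k + 1)) x + stieltjes (α + 1) (q α k) x) := by
  have hα' : -1 < α + 1 := by linarith
  have h := congrArg (fun f => stieltjes (α + 1) f x) (p_succ_sub_p hα k)
  simp only [stieltjes_add hα' hx, stieltjes_sub hα' hx] at h
  rw [mul_stieltjes_p hα hx, mul_stieltjes_p hα hx]
  linear_combination -h

theorem a1_eq (α : ℝ) (n : ℕ) :
    a1 α (n + 1) = ratio α n * ratio α (n + 1) * (1 / (α + n + 1)) := by
  rw [mul_one_div, ratio, ratio, a1, div_mul_div_comm, div_div]
  push_cast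
  congr 1 <;> ring

theorem a3_eq (α : ℝ) (n : ℕ) :
    a3 α (n + 1) = ratio α (n + 1) * ratio α (n + 2) * (1 / (α + n + 2)) := by
  rw [mul_one_div, ratio, ratio, a3, div_mul_div_comm, div_div]
  push_cast
  congr 1 <;> ring

theorem a4_eq (α : ℝ) (n : ℕ) : a4 α (n + 1) = 2 * ratio α (n + 1) * (1 / (α + n + 1)) := by
  rw [mul_one_div, ratio, a4, ← mul_div_assoc, mul_div_mul_left _ _ two_ne_zero, div_div]
  push_cast
  congr 1
  ring

theorem a5_eq (α : ℝ) (n : ℕ) : a5 α (n + 1) = 2 * ratio α (n + 1) * (1 / (α + n + 2)) := by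
  rw [mul_one_div, ratio, a5, ← mul_div_assoc, mul_div_mul_left _ _ two_ne_zero, div_div]
  push_cast
  congr 1
  ring

theorem a2_eq {α : ℝ} (hα : -1 < α) (n : ℕ) :
    a2 α (n + 1) = ratio α (n + 1)
      * (2 - ratio α (n + 1) * (1 / (α + n + 1) + 1 / (α + n + 2))) := by
  have hn : (0 : ℝ) ≤ n := n.cast_nonneg
  have h := ratio_mul hα (n + 1)
  have h0 : 2 * α + 2 * (n + 1 : ℕ) + 1 ≠ 0 := by push_cast; linarith
  have h1 : α + n + 1 ≠ 0 := by linarith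
  have h2 : α + n + 2 ≠ 0 := by linarith
  have h3 : a2 α (n + 1) = ratio α (n + 1) * (4 * α ^ 2 + 4 * α + 3 * ((n + 1 : ℕ) : ℝ) ^ 2
      + 6 * α * (n + 1 : ℕ) + 3 * (n + 1 : ℕ)) / (2 * ((α + n + 1) * (α + n + 2))) := by
    rw [a2, ← h]
    generalize ratio α (n + 1) = r
    rw [div_eq_div_iff]
    · push_cast
      ring
    · push_cast at h0 ⊢
      exact mul_ne_zero (mul_ne_zero (mul_ne_zero four_ne_zero (by linarith)) (by linarith)) h0
    · exact mul_ne_zero two_ne_zero (mul_ne_zero h1 h2)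
  rw [h3, div_eq_iff (mul_ne_zero two_ne_zero (mul_ne_zero h1 h2))]
  have e : (1 / (α + n + 1) + 1 / (α + n + 2)) * (2 * ((α + n + 1) * (α + n + 2)))
      = 2 * (2 * α + 2 * n + 3) := by
    field_simp
    ring
  push_cast at h ⊢
  linear_combination ratio α (n + 1) * (ratio α (n + 1) * e + h)

end CauchyLaguerre

open CauchyLaguerre in
/-- The polynomials `p_k`, `q_k` are biorthogonal with nonzero constants `h_k`, and the diagonal
kernels have the stated derivatives at every `x > 0`. For `m = 1` the terms with index `m - 2`
carry the coefficient `a1 = 0`. -/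
theorem proposition2 (α : ℝ) (hα : -1 < α) (m : ℕ) (hm : 1 ≤ m) :
    (∀ k l : ℕ,
      IntegrableOn (fun z : ℝ × ℝ => (p α k).eval z.1 * (q α l).eval z.2 * W α z.1 z.2)
        (Ioi (0 : ℝ) ×ˢ Ioi (0 : ℝ)) ∧
      pairing α k l = if k = l then h α k else 0) ∧
    (∀ k : ℕ, h α k ≠ 0) ∧
    (∀ x : ℝ, 0 < x →
      HasDerivAt (fun t : ℝ => t * K01 α m t t)
        (S α (m - 1) / S α m * x ^ α * Real.exp (-x) *
          ((p α m).eval x * Q α (m - 1) (-x) + (p α (m - 1)).eval x * Q α m (-x))) x) ∧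
    (∀ x : ℝ, 0 < x →
      HasDerivAt (fun t : ℝ => t * K10 α m t t)
        (S α (m - 1) / S α m * x ^ (α + 1) * Real.exp (-x) *
          (P α m (-x) * (q α (m - 1)).eval x + P α (m - 1) (-x) * (q α m).eval x)) x) ∧
    (∀ x : ℝ, 0 < x →
      HasDerivAt (fun t : ℝ => t * (K01 α m t t + K10 α m t t))
        (-x ^ α * Real.exp (-x) *
          (a1 α m * ((q α (m - 1)).eval x * Q α (m - 2) (-x)
              - (q α (m - 2)).eval x * Q α (m - 1) (-x))
            + a2 α m * ((q α (m - 1)).eval x * Q α m (-x)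
              - (q α m).eval x * Q α (m - 1) (-x))
            + a3 α m * ((q α (m + 1)).eval x * Q α m (-x)
              - (q α m).eval x * Q α (m + 1) (-x))
            - x * (a4 α m * ((q α (m - 1)).eval x * Q α (m - 1) (-x))
              + a5 α m * ((q α m).eval x * Q α m (-x))))) x) := by
  obtain ⟨n, rfl⟩ : ∃ n, m = n + 1 := ⟨m - 1, by omega⟩
  refine ⟨fun k l => ⟨integrableOn_bilin hα _ _, ?_⟩, fun k => ?_, fun x hx => ?_, fun x hx => ?_,
    fun x hx => ?_⟩
  · rw [h_eq_one hα]
    exact bilin_p_q hα k l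
  · rw [h_eq_one hα]
    exact one_ne_zero
  · refine (hasDerivAt_mul_K01 hα (n + 1) hx).congr_deriv ?_
    simp only [Nat.add_sub_cancel, S_div_S hα, Q_neg]
    ring
  · refine (hasDerivAt_mul_K10 hα (n + 1) hx).congr_deriv ?_
    simp only [Nat.add_sub_cancel, S_div_S hα, P_neg]
    ring
  · have hd := (hasDerivAt_mul_K01 hα (n + 1) hx).add (hasDerivAt_mul_K10 hα (n + 1) hx)
    have hf : (fun t : ℝ => t * (K01 α (n + 1) t t + K10 α (n + 1) t t))
        = (fun t => t * K01 α (n + 1) t t) + fun t => t * K10 α (n + 1) t t := by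
      ext t
      exact mul_add _ _ _
    rw [hf]
    refine hd.congr_deriv ?_
    have hn : (0 : ℝ) ≤ n := n.cast_nonneg
    have hg : (α + n + 2) * (1 / (α + n + 2)) = 1 := mul_one_div_cancel (by linarith)
    have hg' : (α + n + 1) * (1 / (α + n + 1)) = 1 := mul_one_div_cancel (by linarith)
    have h1 := mul_eval_p hα (n + 1) x
    have h2 := mul_eval_p hα n x
    have h3 := mul_mul_stieltjes_p hα hx (n + 1)
    have h4 := mul_mul_stieltjes_p hα hx n
    have h5 := congrArg (Polynomial.eval x) (p_succ_sub_p hα n)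
    have h6 := mul_stieltjes_p_succ_sub hα hx n
    rw [Polynomial.eval_sub, Polynomial.eval_add] at h5
    rw [a1_eq, a2_eq hα, a3_eq, a4_eq, a5_eq, Real.rpow_add_one hx.ne']
    -- For `n = 0` the index `n - 1` truncates to `0`, harmlessly: its terms carry the factor `ratio
    -- α 0 = 0`.
    simp only [Nat.add_sub_cancel, show n + 1 - 2 = n - 1 by omega, Q_neg, add_assoc n 1 1,
      one_add_one_eq_two] at h1 h3 ⊢
    push_cast at h1 h3
    generalize 1 / (α + (n : ℝ) + 1) = g' at hg' ⊢
    generalize 1 / (α + (n : ℝ) + 2) = g at hg ⊢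
    generalize stieltjes α (p α (n + 1)) x = U at *
    generalize stieltjes α (p α n) x = U' at *
    generalize stieltjes (α + 1) (q α (n - 1)) x = T'' at *
    generalize stieltjes (α + 1) (q α (n + 1)) x = T at *
    generalize stieltjes (α + 1) (q α (n + 2)) x = T₁ at *
    generalize stieltjes (α + 1) (q α n) x = T' at *
    generalize (p α (n + 1)).eval x = f at *
    generalize (p α n).eval x = f' at *
    generalize (q α (n + 1)).eval x = e at *
    generalize (q α (n + 2)).eval x = e₁ at *
    generalize (q α (n - 1)).eval x = e'' at *
    generalize (q α n).eval x = e' at *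
    generalize ratio α (n + 1) = r at *
    generalize ratio α (n + 2) = r₁ at *
    generalize ratio α n = r' at *
    -- `h5` and `h6` replace `f T' + f' T + x (U e' + U' e)` by `f T + f' T' + x (U e + U' e') + 2
    -- (e T' - e' T)`, the source of the `2` in `a2_eq`. Expanding `f`, `f'`, `x U`, `x U'` by
    -- `h1`–`h4` then cancels the `r₁ - r` and `r - r'` terms and leaves the antisymmetric products
    -- and those with factor `x`.
    linear_combination x ^ α * Real.exp (-x) * r * ((T - T') * h5 + (e - e') * h6
      - T' * (g' * h2 - f' * hg') - T * (g * h1 - f * hg)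
      - e' * (g' * h4 - x * U' * hg') - e * (g * h3 - x * U * hg))
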